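/- Let $m\ge 1$ be an integer and put $c_m=\frac{m}{m+1}$. For an integer $N\ge 0$ and $x\in\mathbb Z_{m+1}^N$ let $|x|$ be the number of nonzero coordinates of $x$, and for an integer $0\le r\le N$ let $$\sigma_r=\frac{1}{\#\{x:|x|=r\}}\,1_{\{x:|x|=r\}}$$ be the normalized indicator function of the sphere of radius $r$. Let $*$ denote convolution on $\mathbb Z_{m+1}^N$ with respect to counting measure, $(g*f)(x)=\sum_{y}g(y)f(x-y)$. For $f:\mathbb Z_{m+1}^N\to\mathbb C$ define the smooth local spherical maximal function $$M^L_Sf(x)=\sup_{\substack{K\in\mathbb Z\\ 0\le K\le c_mN}}\left|\frac1{K+1}\sum_{k=0}^{K}(\sigma_k*f)(x)\right| .$$ Proposition. The operator $M^L_S$ is of weak type $(1,1)$ with a bound independent of $N$: for every $m\ge1$ there is a constant $C_{1,m}<\infty$, depending only on $m$, such that for all $N$ and all $f:\mathbb Z_{m+1}^N\to\mathbb C$, $$\|M^L_Sf\|_{L^{1,\infty}(\mathbb Z_{m+1}^N)}:=\sup_{t>0}\,t\cdot\#\{x: M^L_Sf(x)>t\}\;\le\; C_{1,m}\sum_{x\in\mathbb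 Z_{m+1}^N}|f(x)| .$$ -/

import Mathlib

open scoped ENNReal NNReal

namespace HammingMaximal

/-- The group `(ℤ/(m+1))^N`. -/
abbrev Torus (m N : ℕ) : Type := Fin N → ZMod (m + 1)

/-- The sphere of radius `r` about the origin; `hammingNorm x` is the number of nonzero
coordinates of `x`. -/
def sphere (m N r : ℕ) : Finset (Torus m N) :=
  Finset.univ.filter fun x => hammingNorm x = r

/-- The `L¹`-normalized indicator function of the sphere of radius `r`. -/
noncomputable def sigma (m N r : ℕ) (x : Torus m N) : ℂ :=
  if x ∈ sphere m N r then ((sphere m N r).card : ℂ)⁻¹ else 0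

/-- Convolution of functions on `(ℤ/(m+1))^N` with respect to counting measure. -/
noncomputable def conv {m N : ℕ} (g f : Torus m N → ℂ) (x : Torus m N) : ℂ :=
  ∑ y, g y * f (x - y)

/-- The constant `c_m = m / (m + 1)`. -/
noncomputable def c (m : ℕ) : ℝ := (m : ℝ) / ((m : ℝ) + 1)

/-- The average `(K + 1)⁻¹ ∑_{k ≤ K} σ_k * f`. -/
noncomputable def smoothAverage {m N : ℕ} (K : ℕ) (f : Torus m N → ℂ) (x : Torus m N) : ℂ :=
  ((K : ℂ) + 1)⁻¹ * ∑ k ∈ Finset.range (K + 1), conv (sigma m N k) f x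

/-- The smooth local spherical maximal function `sup_{K ≤ c_m N} |(K + 1)⁻¹ ∑_{k ≤ K} σ_k * f|`.
The supremum is over a finite nonempty set of integers `K ≥ 0`, see `isGreatest_smoothLocalMax`. -/
noncomputable def smoothLocalMax {m N : ℕ} (f : Torus m N → ℂ) (x : Torus m N) : ℝ :=
  ⨆ K : {K : ℕ // (K : ℝ) ≤ c m * N}, ‖smoothAverage K f x‖

/-- The `L¹` norm with respect to counting measure. -/
noncomputable def l1Norm {α : Type*} [Fintype α] (f : α → ℂ) : ℝ≥0∞ :=
  ∑ x, ‖f x‖ₑ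

/-- The weak `L¹` quasinorm `sup_{t > 0} t · #{x : |g x| > t}` with respect to counting
measure. -/
noncomputable def weakL1Norm {α : Type*} [Fintype α] (g : α → ℝ) : ℝ≥0∞ :=
  ⨆ t : ℝ≥0, (t : ℝ≥0∞) * ((Finset.univ.filter fun x => (t : ℝ) < |g x|).card : ℝ≥0∞)

theorem isGreatest_smoothLocalMax {m N : ℕ} (f : Torus m N → ℂ) (x : Torus m N) :
    IsGreatest {a : ℝ | ∃ K : ℕ, (K : ℝ) ≤ c m * N ∧ a = ‖smoothAverage K f x‖}
      (smoothLocalMax f x) := by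
  have hc : 0 ≤ c m * N := by unfold c; positivity
  have : Nonempty {K : ℕ // (K : ℝ) ≤ c m * N} := ⟨⟨0, by simpa using hc⟩⟩
  have : Finite {K : ℕ // (K : ℝ) ≤ c m * N} :=
    ((Set.finite_Iic ⌊c m * N⌋₊).subset fun K hK => Nat.le_floor hK).to_subtype
  constructor
  · obtain ⟨K, hK⟩ := exists_eq_ciSup_of_finite
      (f := fun K : {K : ℕ // (K : ℝ) ≤ c m * N} => ‖smoothAverage K f x‖)
    exact ⟨K, K.2, hK.symm⟩
  · rintro a ⟨K, hK, rfl⟩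
    exact le_ciSup (f := fun K : {K : ℕ // (K : ℝ) ≤ c m * N} => ‖smoothAverage K f x‖)
      (Set.finite_range _).bddAbove ⟨K, hK⟩

end HammingMaximal

/-! Averaging over radii allows spheres to be compared with noise operators. Noise kernels with
keeping probability `s` compose by multiplying `s`, so the powers of one Markov operator `T`, with
`s = 1 - η`, run through a grid of them. Hopf's theorem bounds the maximal ergodic averages of `T`
in weak `L¹` with constant 1, whatever `N` and `η` are.

On the sphere of radius `k` the noise kernel is the binomial probability of `k` with parameter `p =
c_m (1 - s)`, spread uniformly. Its integral over `0 ≤ p ≤ P` is `binomTail (N + 1) (k + 1) P / (N +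
1)`. With `P` of order `(K + 1) / (N + 1)` these tails are bounded below for all `k ≤ K`
(`exists_le_binomTail`), so the average up to `K` is dominated by noise operators integrated over
`[0, P]`. The integral is replaced by a Riemann sum over the grid (`exists_riemann_sum_ge`), whose
weights decrease, so `sum_antitone_mul_le` passes to ergodic averages. The total weight is at most
`P` and `P (N + 1) ≤ 4 (K + 1)`, so the dimension cancels. -/

namespace HammingMaximal

/-! ### Maximal ergodic theorem and Abel summation. -/

/-- Hopf's maximal ergodic theorem on a finite set, by Garsia's argument. -/
theorem hopf_maximal {X : Type*} [Fintype X] (T : Module.End ℝ (X → ℝ))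
    (hpos : ∀ g, 0 ≤ g → 0 ≤ T g) (hint : ∀ g, 0 ≤ g → ∑ x, T g x ≤ ∑ x, g x)
    (h : X → ℝ) (n : ℕ) (E : Finset X)
    (hE : ∀ x, x ∈ E ↔ ∃ k ≤ n, 0 < ∑ j ∈ Finset.range k, (T ^ j) h x) :
    0 ≤ ∑ x ∈ E, h x := by
  classical
  set S : ℕ → X → ℝ := fun k => ∑ j ∈ Finset.range k, (T ^ j) h with hS
  have hSx : ∀ k x, S k x = ∑ j ∈ Finset.range k, (T ^ j) h x := fun k x => by
    simp [hS, Finset.sum_apply]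
  have hSsucc : ∀ k, S (k + 1) = h + T (S k) := fun k => by
    simp only [hS]
    rw [Finset.sum_range_succ', map_sum, add_comm]
    simp [pow_succ']
  have hne : (Finset.range (n + 1)).Nonempty := ⟨0, by simp⟩
  set M : X → ℝ := fun x => (Finset.range (n + 1)).sup' hne fun k => S k x with hM
  have hSM : ∀ k ≤ n, S k ≤ M := fun k hk x =>
    Finset.le_sup' (fun k => S k x) (Finset.mem_range.2 (Nat.lt_succ_of_le hk))
  have hM0 : 0 ≤ M := by
    have := hSM 0 n.zero_le
    simpa [hS] using this
  have hmono : ∀ g g', g ≤ g' → T g ≤ T g' := fun g g' hg => by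
    have := hpos (g' - g) (sub_nonneg.2 hg)
    rw [map_sub] at this
    exact sub_nonneg.1 this
  have hin : ∀ x ∈ E, M x - T M x ≤ h x := by
    intro x hx
    obtain ⟨k₀, hk₀, hpos₀⟩ := (hE x).1 hx
    obtain ⟨k, hk, hkM⟩ := Finset.exists_mem_eq_sup' hne (fun k => S k x)
    have hMk : M x = S k x := hkM
    have hMpos : 0 < M x := by
      have := hSM k₀ hk₀ x
      rw [hSx] at this
      linarith
    -- The maximum is positive, so it is not attained by the empty sum, and `S (k + 1) = h + T (S k)
    -- ≤ h + T M`.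
    cases k with
    | zero => simp [hMk, hS] at hMpos
    | succ k =>
      have hkn : k ≤ n := by have := Finset.mem_range.1 hk; omega
      have h1 := hmono _ _ (hSM k hkn) x
      have h2 := congrFun (hSsucc k) x
      simp only [Pi.add_apply] at h2
      linarith
  have hout : ∀ x ∉ E, M x = 0 := by
    intro x hx
    refine le_antisymm (Finset.sup'_le hne _ fun k hk => ?_) (hM0 x)
    by_contra hlt
    exact hx ((hE x).2 ⟨k, Nat.lt_succ_iff.1 (Finset.mem_range.1 hk), by
      rw [← hSx]; exact not_le.1 hlt⟩)
  calc (0 : ℝ) ≤ ∑ x, M x - ∑ x, T M x := sub_nonneg.2 (hint M hM0)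
    -- Off `E` the function `M` vanishes while `T M` stays nonnegative.
    _ ≤ ∑ x ∈ E, M x - ∑ x ∈ E, T M x := by
      refine sub_le_sub (le_of_eq ?_) ?_
      · exact (Finset.sum_subset (Finset.subset_univ E) fun x _ hx => hout x hx).symm
      · exact Finset.sum_le_sum_of_subset_of_nonneg (Finset.subset_univ E)
          fun x _ _ => hpos M hM0 x
    _ = ∑ x ∈ E, (M x - T M x) := by rw [Finset.sum_sub_distrib]
    _ ≤ ∑ x ∈ E, h x := Finset.sum_le_sum hin

/-- The weak type `(1,1)` bound for the ergodic averages of a Markov operator that does not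
increase integrals. -/
theorem card_ergodic_le {X : Type*} [Fintype X] (T : Module.End ℝ (X → ℝ))
    (hpos : ∀ g, 0 ≤ g → 0 ≤ T g) (hint : ∀ g, 0 ≤ g → ∑ x, T g x ≤ ∑ x, g x)
    (hone : T 1 = 1) {F : X → ℝ} (hF : 0 ≤ F) (t : ℝ) (n : ℕ) (E : Finset X)
    (hE : ∀ x, x ∈ E ↔ ∃ k ≤ n, (k : ℝ) * t < ∑ j ∈ Finset.range k, (T ^ j) F x) :
    t * E.card ≤ ∑ x, F x := by
  have hpow : ∀ j : ℕ, (T ^ j) 1 = 1 := fun j => by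
    induction j with
    | zero => simp
    | succ j ih => rw [pow_succ, Module.End.mul_apply, hone, ih]
  have key := hopf_maximal T hpos hint (F - t • 1) n E (fun x => by
    rw [hE]
    refine exists_congr fun k => and_congr_right fun _ => ?_
    simp [hpow, Finset.sum_sub_distrib])
  have hle : ∑ x ∈ E, F x ≤ ∑ x, F x :=
    Finset.sum_le_sum_of_subset_of_nonneg (Finset.subset_univ E) fun x _ _ => hF x
  simp [Finset.sum_sub_distrib] at key
  linarith

/-- Abel summation: averages with nonincreasing weights are bounded by uniform averages. -/
theorem sum_antitone_mul_le {w a : ℕ → ℝ} {t : ℝ} (hw : Antitone w) (hw0 : ∀ j, 0 ≤ w j)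
    (n : ℕ) (ha : ∀ k ≤ n, ∑ j ∈ Finset.range k, a j ≤ k * t) :
    ∑ j ∈ Finset.range n, w j * a j ≤ (∑ j ∈ Finset.range n, w j) * t := by
  have key : ∀ k, k + 1 ≤ n → ∑ j ∈ Finset.range (k + 1), w j * (a j - t) ≤
      w k * ∑ j ∈ Finset.range (k + 1), (a j - t) := by
    intro k
    induction k with
    | zero => simp
    | succ k ih =>
      intro hk
      rw [Finset.sum_range_succ, Finset.sum_range_succ _ (k + 1), mul_add]
      have h1 := ih (by omega)
      have h2 : ∑ j ∈ Finset.range (k + 1), (a j - t) ≤ 0 := by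
        have := ha (k + 1) (by omega)
        simp only [Finset.sum_sub_distrib, Finset.sum_const, Finset.card_range, nsmul_eq_mul]
        linarith
      -- The centred partial sum is nonpositive, so a smaller weight only increases the product.
      have h3 := mul_le_mul_of_nonpos_right (hw (Nat.le_succ k)) h2
      linarith
  cases n with
  | zero => simp
  | succ k =>
    have h1 := key k le_rfl
    have h2 : ∑ j ∈ Finset.range (k + 1), (a j - t) ≤ 0 := by
      have := ha (k + 1) le_rfl
      simp only [Finset.sum_sub_distrib, Finset.sum_const, Finset.card_range, nsmul_eq_mul]
      linarith
    have h3 := mul_nonpos_of_nonneg_of_nonpos (hw0 k) h2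
    rw [Finset.sum_mul, ← sub_nonpos, ← Finset.sum_sub_distrib]
    simp only [mul_sub] at h1 h3 ⊢
    linarith

/-! ### Convolution operators. -/

/-- Convolution with a real kernel on a finite group, as a linear operator. -/
def convEnd {G : Type*} [Fintype G] [AddCommGroup G] (g : G → ℝ) : Module.End ℝ (G → ℝ) where
  toFun F x := ∑ y, g y * F (x - y)
  map_add' F F' := by ext x; simp [mul_add, Finset.sum_add_distrib]
  map_smul' r F := by ext x; simp [Finset.mul_sum, mul_left_comm]

section convEnd
variable {G : Type*} [Fintype G] [AddCommGroup G]

theorem convEnd_apply (g F : G → ℝ) (x : G) : convEnd g F x = ∑ y, g y * F (x - y) := rfl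

theorem convEnd_mul (g h : G → ℝ) : convEnd g * convEnd h = convEnd (convEnd g h) := by
  ext F x
  simp only [Module.End.mul_apply, convEnd_apply, Finset.mul_sum, Finset.sum_mul]
  rw [Finset.sum_comm' (t' := Finset.univ) (s' := fun _ => Finset.univ) (by simp)]
  rw [Finset.sum_comm]
  conv_rhs => rw [Finset.sum_comm]
  refine Finset.sum_congr rfl fun y _ => ?_
  rw [← Equiv.sum_comp (Equiv.subRight y)]
  refine Finset.sum_congr rfl fun z _ => ?_
  simp [mul_assoc, sub_sub]

theorem convEnd_nonneg {g : G → ℝ} (hg : 0 ≤ g) (F : G → ℝ) (hF : 0 ≤ F) : 0 ≤ convEnd g F :=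
  fun x => Finset.sum_nonneg fun y _ => mul_nonneg (hg y) (hF (x - y))

theorem sum_convEnd (g F : G → ℝ) : ∑ x, convEnd g F x = (∑ y, g y) * ∑ x, F x := by
  simp only [convEnd_apply]
  rw [Finset.sum_comm, Finset.sum_mul]
  refine Finset.sum_congr rfl fun y _ => ?_
  rw [← Finset.mul_sum, ← Equiv.sum_comp (Equiv.subRight y) F]
  rfl

theorem convEnd_one (g : G → ℝ) (hg : ∑ y, g y = 1) : convEnd g 1 = 1 := by
  ext x; simp [convEnd_apply, hg]

end convEnd

/-! ### The noise semigroup and the sizes of spheres. -/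

/-- The kernel of the noise operator: every coordinate is kept with probability `s`, and
otherwise resampled uniformly. -/
noncomputable def noise (m N : ℕ) (s : ℝ) (y : Torus m N) : ℝ :=
  ∏ i, ((if y i = 0 then s else 0) + (1 - s) / (m + 1))

variable {m N : ℕ}

theorem noise_nonneg {s : ℝ} (h0 : 0 ≤ s) (h1 : s ≤ 1) : 0 ≤ noise m N s := fun y =>
  Finset.prod_nonneg fun i _ => add_nonneg (by split_ifs <;> simp [h0])
    (div_nonneg (by linarith) (by positivity))

/-- The kernels are products over coordinates, so a one-coordinate check suffices: a coordinate
survives both noises with probability `s * s'`, and is otherwise uniform. -/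
theorem convEnd_noise (s s' : ℝ) :
    convEnd (noise m N s) (noise m N s') = noise m N (s * s') := by
  ext u
  simp only [convEnd_apply, noise, ← Finset.prod_mul_distrib, Pi.sub_apply]
  rw [← Fintype.prod_sum fun i (a : ZMod (m + 1)) => ((if a = 0 then s else 0) + (1 - s) / (m + 1)) *
    ((if u i - a = 0 then s' else 0) + (1 - s') / (m + 1) : ℝ)]
  refine Finset.prod_congr rfl fun i _ => ?_
  have hm : (m : ℝ) + 1 ≠ 0 := by positivity
  have hterm : ∀ a : ZMod (m + 1), ((if a = 0 then s else 0) + (1 - s) / (m + 1)) *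
      ((if u i - a = 0 then s' else 0) + (1 - s') / (m + 1) : ℝ) =
      (if a = 0 then (if u i = 0 then s * s' else 0) + s * ((1 - s') / (m + 1)) else 0) +
      (if u i = a then s' * ((1 - s) / (m + 1)) else 0) + (1 - s) / (m + 1) * ((1 - s') / (m + 1)) := by
    intro a
    by_cases ha : a = 0 <;> by_cases hu : u i = a <;> simp_all [sub_eq_zero] <;> ring
  simp only [hterm, Finset.sum_add_distrib, Finset.sum_ite_eq, Finset.sum_ite_eq', Finset.mem_univ,
    if_true, Finset.sum_const, Finset.card_univ, ZMod.card, nsmul_eq_mul]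
  push_cast
  field_simp
  split_ifs <;> ring

theorem sum_noise (s : ℝ) : ∑ y, noise m N s y = 1 := by
  simp only [noise]
  rw [← Fintype.prod_sum fun (_ : Fin N) (a : ZMod (m + 1)) =>
    ((if a = 0 then s else 0) + (1 - s) / (m + 1) : ℝ)]
  refine Finset.prod_eq_one fun i _ => ?_
  have hm : (m : ℝ) + 1 ≠ 0 := by positivity
  simp only [Finset.sum_add_distrib, Finset.sum_ite_eq', Finset.mem_univ, if_true,
    Finset.sum_const, Finset.card_univ, ZMod.card, nsmul_eq_mul]
  push_cast
  field_simp
  ring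

theorem convEnd_noise_pow (q : ℝ) (j : ℕ) :
    convEnd (noise m N q) ^ j = convEnd (noise m N (q ^ j)) := by
  induction j with
  | zero =>
    ext F x
    have h1 : ∀ y : Torus m N, noise m N 1 y = if y = 0 then 1 else 0 := fun y => by
      simp [noise, Finset.prod_ite_zero, funext_iff]
    simp [convEnd_apply, h1]
  | succ j ih => rw [pow_succ, ih, convEnd_mul, convEnd_noise, pow_succ]

/-- The noise kernel on a sphere, in terms of `p = c_m (1 - s)`. -/
theorem noise_eq (hm : 1 ≤ m) (s : ℝ) (y : Torus m N) :
    noise m N s y * (m : ℝ) ^ hammingNorm y =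
      (c m * (1 - s)) ^ hammingNorm y * (1 - c m * (1 - s)) ^ (N - hammingNorm y) := by
  have hm' : (m : ℝ) ≠ 0 := by positivity
  have hm1 : (m : ℝ) + 1 ≠ 0 := by positivity
  have hpow : ∀ a b : ℝ, ∏ i, (if y i = 0 then a else b) =
      b ^ hammingNorm y * a ^ (N - hammingNorm y) := fun a b => by
    have hcard := Finset.card_filter_add_card_filter_not
      (s := (Finset.univ : Finset (Fin N))) (fun i => y i = 0)
    have hn : hammingNorm y = (Finset.univ.filter fun i => ¬ y i = 0).card := rfl
    rw [Finset.prod_ite, Finset.prod_const, Finset.prod_const, mul_comm, hn]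
    congr 2
    simp at hcard
    omega
  have h2 : (m : ℝ) ^ hammingNorm y = ∏ i, (if y i = 0 then (1 : ℝ) else m) := by
    rw [hpow]; simp
  rw [← hpow, h2, noise, ← Finset.prod_mul_distrib]
  refine Finset.prod_congr rfl fun i _ => ?_
  unfold c
  split_ifs <;> field_simp <;> ring

theorem card_sphere (m N k : ℕ) : (sphere m N k).card = N.choose k * m ^ k := by
  classical
  have hsup : ∀ S : Finset (Fin N),
      (Finset.univ.filter fun x : Torus m N => (Finset.univ.filter fun i => x i ≠ 0) = S).card =
        m ^ S.card := by
    intro S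
    have : (Finset.univ.filter fun x : Torus m N => (Finset.univ.filter fun i => x i ≠ 0) = S) =
        Fintype.piFinset fun i => if i ∈ S then (Finset.univ.erase 0) else {0} := by
      ext x
      simp only [Finset.mem_filter, Finset.mem_univ, true_and, Fintype.mem_piFinset,
        Finset.ext_iff]
      refine forall_congr' fun i => ?_
      by_cases hi : i ∈ S <;> simp [hi]
    rw [this, Fintype.card_piFinset]
    simp [apply_ite Finset.card]
  have hS : sphere m N k = (Finset.powersetCard k Finset.univ).biUnion fun S =>
      Finset.univ.filter fun x : Torus m N => (Finset.univ.filter fun i => x i ≠ 0) = S := by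
    ext x
    simp [sphere, hammingNorm, Finset.mem_powersetCard]
  rw [hS, Finset.card_biUnion]
  · rw [Finset.sum_congr rfl fun S hS => by rw [hsup, (Finset.mem_powersetCard.1 hS).2]]
    simp
  · intro S _ S' _ hne
    refine Finset.disjoint_left.2 fun x hx hx' => hne ?_
    exact (Finset.mem_filter.1 hx).2.symm.trans (Finset.mem_filter.1 hx').2

/-! ### Binomial probabilities and tails. -/

/-- The probability that a binomial variable with parameters `n`, `x` equals `k`. -/
noncomputable def binomProb (n k : ℕ) (x : ℝ) : ℝ := (bernsteinPolynomial ℝ n k).eval x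

/-- The probability that a binomial variable with parameters `n`, `x` is at least `k`. -/
noncomputable def binomTail (n k : ℕ) (x : ℝ) : ℝ := ∑ v ∈ Finset.Ico k (n + 1), binomProb n v x

theorem binomProb_eq (n k : ℕ) (x : ℝ) :
    binomProb n k x = n.choose k * x ^ k * (1 - x) ^ (n - k) := by
  simp [binomProb, bernsteinPolynomial]

theorem binomProb_nonneg (n k : ℕ) {x : ℝ} (hx : x ∈ Set.Icc (0 : ℝ) 1) : 0 ≤ binomProb n k x := by
  have h1 := hx.1
  have h2 := sub_nonneg.2 hx.2
  rw [binomProb_eq]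
  positivity

theorem sum_binomProb (n : ℕ) (x : ℝ) : ∑ v ∈ Finset.range (n + 1), binomProb n v x = 1 := by
  have := congrArg (Polynomial.eval x) (bernsteinPolynomial.sum ℝ n)
  simpa [Polynomial.eval_finsetSum, binomProb] using this

theorem binomProb_le_one (n k : ℕ) {x : ℝ} (hx : x ∈ Set.Icc (0 : ℝ) 1) : binomProb n k x ≤ 1 := by
  rcases Nat.lt_or_ge n k with h | h
  · simp [binomProb, bernsteinPolynomial.eq_zero_of_lt ℝ h]
  · rw [← sum_binomProb n x]
    exact Finset.single_le_sum (f := fun v => binomProb n v x)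
      (fun v _ => binomProb_nonneg n v hx) (Finset.mem_range.2 (by omega))

/-- The derivatives of the Bernstein polynomials telescope. This identifies the integral of
`binomProb n k` from `0` with a tail. -/
theorem hasDerivAt_binomTail (n k : ℕ) (x : ℝ) :
    HasDerivAt (binomTail (n + 1) (k + 1)) ((n + 1) * binomProb n k x) x := by
  have h : ∀ v ∈ Finset.Ico (k + 1) (n + 1 + 1), HasDerivAt (binomProb (n + 1) v)
      ((n + 1) * (binomProb n (v - 1) x - binomProb n v x)) x := by
    intro v hv
    obtain ⟨w, rfl⟩ : ∃ w, v = w + 1 := ⟨v - 1, by have := (Finset.mem_Ico.1 hv).1; omega⟩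
    have := (bernsteinPolynomial ℝ (n + 1) (w + 1)).hasDerivAt x
    rw [bernsteinPolynomial.derivative_succ] at this
    refine HasDerivAt.congr_deriv (f := binomProb (n + 1) (w + 1)) this ?_
    simp [binomProb]
  have hs := HasDerivAt.fun_sum h
  refine (hs.congr_deriv ?_ : HasDerivAt (fun x => ∑ v ∈ Finset.Ico (k + 1) (n + 1 + 1), _) _ x)
  rw [← Finset.mul_sum]
  congr 1
  rcases Nat.lt_or_ge n k with hk | hk
  · rw [Finset.Ico_eq_empty (by omega)]
    simp [binomProb, bernsteinPolynomial.eq_zero_of_lt ℝ hk]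
  · rw [← Finset.sum_Ico_add' _ k (n + 1) 1]
    have := Finset.sum_Ico_sub (fun v => binomProb n v x) (m := k) (n := n + 1) (by omega)
    have h0 : binomProb n (n + 1) x = 0 := by
      simp [binomProb, bernsteinPolynomial.eq_zero_of_lt ℝ n.lt_succ_self]
    simp only [Nat.add_sub_cancel]
    rw [← neg_inj, ← Finset.sum_neg_distrib]
    simp only [neg_sub]
    linarith

theorem abs_deriv_binomProb_le (n k : ℕ) {x : ℝ} (hx : x ∈ Set.Icc (0 : ℝ) 1) :
    ‖((bernsteinPolynomial ℝ n k).derivative).eval x‖ ≤ n := by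
  have hb : ∀ v, 0 ≤ binomProb (n - 1) v x ∧ binomProb (n - 1) v x ≤ 1 := fun v =>
    ⟨binomProb_nonneg _ _ hx, binomProb_le_one _ _ hx⟩
  have hn : (0 : ℝ) ≤ n := n.cast_nonneg
  cases k with
  | zero =>
    have := hb 0
    rw [bernsteinPolynomial.derivative_zero, Polynomial.eval_mul]
    simp only [Polynomial.eval_neg, Polynomial.eval_natCast, norm_mul, norm_neg, Real.norm_natCast]
    refine mul_le_of_le_one_right hn ?_
    rw [Real.norm_eq_abs, abs_le]
    constructor <;> simp only [binomProb] at this <;> linarith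
  | succ k =>
    have h1 := hb k
    have h2 := hb (k + 1)
    rw [bernsteinPolynomial.derivative_succ, Polynomial.eval_mul, Polynomial.eval_sub]
    simp only [Polynomial.eval_natCast, norm_mul, Real.norm_natCast]
    refine mul_le_of_le_one_right hn ?_
    rw [Real.norm_eq_abs, abs_le]
    constructor <;> simp only [binomProb] at h1 h2 <;> linarith

theorem binomProb_le_add (n k : ℕ) {x y : ℝ} (hx : x ∈ Set.Icc (0 : ℝ) 1)
    (hy : y ∈ Set.Icc (0 : ℝ) 1) (hxy : x ≤ y) :
    binomProb n k y ≤ binomProb n k x + n * (y - x) := by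
  have := (convex_Icc (0 : ℝ) 1).norm_image_sub_le_of_norm_hasDerivWithin_le
    (f := binomProb n k) (C := n)
    (fun z _ => ((bernsteinPolynomial ℝ n k).hasDerivAt z).hasDerivWithinAt)
    (fun z hz => abs_deriv_binomProb_le n k hz) hx hy
  rw [Real.norm_of_nonneg (sub_nonneg.2 hxy)] at this
  have := (le_abs_self _).trans this
  linarith

/-- Both bounds come from the mean value theorem. The first uses the Lipschitz constant `n` to move
the intermediate point to the left endpoint, as a Riemann sum needs; the second serves the leftover
interval. -/
theorem binomTail_sub_le (n k : ℕ) {x y : ℝ} (hx : x ∈ Set.Icc (0 : ℝ) 1)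
    (hy : y ∈ Set.Icc (0 : ℝ) 1) (hxy : x ≤ y) :
    binomTail (n + 1) (k + 1) y - binomTail (n + 1) (k + 1) x ≤
      (n + 1) * ((y - x) * (binomProb n k x + n * (y - x))) ∧
    binomTail (n + 1) (k + 1) y - binomTail (n + 1) (k + 1) x ≤ (n + 1) * (y - x) := by
  rcases hxy.eq_or_lt with rfl | hlt
  · simp
  obtain ⟨z, hz, hslope⟩ := exists_hasDerivAt_eq_slope (binomTail (n + 1) (k + 1)) _ hlt
    (fun z _ => (hasDerivAt_binomTail n k z).continuousAt.continuousWithinAt)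
    (fun z _ => hasDerivAt_binomTail n k z)
  have hd : 0 < y - x := sub_pos.2 hlt
  have hz' : z ∈ Set.Icc (0 : ℝ) 1 := ⟨hx.1.trans hz.1.le, hz.2.le.trans hy.2⟩
  rw [eq_div_iff hd.ne'] at hslope
  have h1 := binomProb_le_one n k hz'
  have h2 := binomProb_le_add n k hx hz' hz.1.le
  have h3 : binomProb n k z ≤ binomProb n k x + n * (y - x) := by
    refine h2.trans ?_
    have := hz.2
    gcongr
  rw [← hslope, mul_assoc, mul_comm (binomProb n k z)]
  constructor
  · gcongr
  · have : (y - x) * binomProb n k z ≤ y - x := mul_le_of_le_one_right hd.le h1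
    gcongr

theorem binomTail_anti (n : ℕ) {k l : ℕ} (h : k ≤ l) {x : ℝ} (hx : x ∈ Set.Icc (0 : ℝ) 1) :
    binomTail n l x ≤ binomTail n k x :=
  Finset.sum_le_sum_of_subset_of_nonneg (Finset.Ico_subset_Ico_left h)
    fun v _ _ => binomProb_nonneg n v hx

/-- Chebyshev's inequality for the lower tail of the binomial distribution. -/
theorem one_sub_le_binomTail (n k : ℕ) {x : ℝ} (hx : x ∈ Set.Icc (0 : ℝ) 1) (hk : k ≤ n)
    (hkx : (k : ℝ) < n * x) :
    1 - n * x / (n * x - k) ^ 2 ≤ binomTail n (k + 1) x := by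
  have hvar : ∑ v ∈ Finset.range (n + 1), (n * x - v) ^ 2 * binomProb n v x = n * x * (1 - x) := by
    have := congrArg (Polynomial.eval x) (bernsteinPolynomial.variance ℝ n)
    simpa [Polynomial.eval_finsetSum, binomProb] using this
  have hd : 0 < (n * x - k : ℝ) := sub_pos.2 hkx
  have hhead : ∑ v ∈ Finset.range (k + 1), binomProb n v x ≤ n * x / (n * x - k) ^ 2 := by
    rw [le_div_iff₀ (by positivity), Finset.sum_mul]
    calc ∑ v ∈ Finset.range (k + 1), binomProb n v x * (n * x - k) ^ 2
        ≤ ∑ v ∈ Finset.range (k + 1), (n * x - v) ^ 2 * binomProb n v x := by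
          refine Finset.sum_le_sum fun v hv => ?_
          rw [mul_comm]
          have hvk : (v : ℝ) ≤ k := by
            exact_mod_cast Nat.lt_succ_iff.1 (Finset.mem_range.1 hv)
          refine mul_le_mul_of_nonneg_right ?_ (binomProb_nonneg n v hx)
          exact pow_le_pow_left₀ hd.le (by linarith) 2
      _ ≤ ∑ v ∈ Finset.range (n + 1), (n * x - v) ^ 2 * binomProb n v x :=
          Finset.sum_le_sum_of_subset_of_nonneg (Finset.range_subset_range.2 (by omega))
            fun v _ _ => mul_nonneg (sq_nonneg _) (binomProb_nonneg n v hx)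
      _ = n * x * (1 - x) := hvar
      _ ≤ n * x := mul_le_of_le_one_right (mul_nonneg n.cast_nonneg hx.1) (by linarith [hx.1])
  have hsum := sum_binomProb n x
  rw [← Finset.sum_range_add_sum_Ico _ (by omega : k + 1 ≤ n + 1)] at hsum
  rw [binomTail]
  linarith

/-- At least `k` successes followed by one more give at least `k + 1` in `n + 1` trials. -/
theorem mul_binomTail_le (n k : ℕ) {x : ℝ} (hx : x ∈ Set.Icc (0 : ℝ) 1) :
    x * binomTail n k x ≤ binomTail (n + 1) (k + 1) x := by
  rw [binomTail, binomTail, ← Finset.sum_Ico_add', Finset.mul_sum]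
  refine Finset.sum_le_sum fun v _ => ?_
  have h1 := hx.1
  have h2 := sub_nonneg.2 hx.2
  have hc : (n.choose v : ℝ) ≤ (n + 1).choose (v + 1) := by
    exact_mod_cast (Nat.choose_succ_succ n v) ▸ Nat.le_add_right _ _
  rw [binomProb_eq, binomProb_eq, Nat.add_sub_add_right]
  calc x * (n.choose v * x ^ v * (1 - x) ^ (n - v))
      = n.choose v * (x ^ (v + 1) * (1 - x) ^ (n - v)) := by ring
    _ ≤ (n + 1).choose (v + 1) * (x ^ (v + 1) * (1 - x) ^ (n - v)) := by gcongr
    _ = _ := by ring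

/-! ### Lower bounds for binomial tails. -/

theorem c_mem (m : ℕ) : c m ∈ Set.Icc (0 : ℝ) 1 := by
  unfold c
  exact ⟨by positivity, (div_le_one (by positivity)).2 (by linarith)⟩

theorem binomProb_c (m N k : ℕ) :
    binomProb N k (c m) = (sphere m N k).card / ((m : ℝ) + 1) ^ N := by
  rcases Nat.lt_or_ge N k with h | h
  · simp [card_sphere, Nat.choose_eq_zero_of_lt h, binomProb_eq]
  have hm1 : (m : ℝ) + 1 ≠ 0 := by positivity
  have h1 : 1 - c m = 1 / ((m : ℝ) + 1) := by unfold c; field_simp; ring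
  rw [binomProb_eq, card_sphere, h1, c, div_pow, div_pow, one_pow]
  obtain ⟨l, rfl⟩ := Nat.exists_eq_add_of_le h
  rw [Nat.add_sub_cancel_left, pow_add]
  push_cast
  field_simp

/-- Some value is taken by at most the average number of coordinates, and all values are
equally likely. -/
theorem card_le_card_large (m N k : ℕ) (hk : (k : ℝ) ≤ c m * N) :
    (m + 1) ^ N ≤ (m + 1) * (Finset.univ.filter fun x : Torus m N => k ≤ hammingNorm x).card := by
  classical
  set A := Finset.univ.filter fun x : Torus m N => k ≤ hammingNorm x with hA
  have hcover : (Finset.univ : Finset (Torus m N)) ⊆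
      (Finset.univ : Finset (ZMod (m + 1))).biUnion fun a => A.image fun x => x + fun _ => a := by
    intro x _
    have hsum : ∑ a : ZMod (m + 1), (Finset.univ.filter fun i => x i = a).card = N := by
      simpa using (Finset.card_eq_sum_card_fiberwise
        (f := x) (s := Finset.univ) (t := Finset.univ) (by simp)).symm
    have hcompl : ∀ a, hammingNorm (x - fun _ => a) +
        (Finset.univ.filter fun i => x i = a).card = N := fun a => by
      have := Finset.card_filter_add_card_filter_not
        (s := (Finset.univ : Finset (Fin N))) (fun i => x i = a)
      simp only [Finset.card_univ, Fintype.card_fin] at this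
      have h2 : hammingNorm (x - fun _ => a) = (Finset.univ.filter fun i => ¬ x i = a).card := by
        simp [hammingNorm, sub_eq_zero]
      omega
    -- The norms of the `m + 1` constant translates add up to `m * N`, so one of them reaches the
    -- average `c m * N ≥ k`.
    obtain ⟨a, ha⟩ : ∃ a, k ≤ hammingNorm (x - fun _ => a) := by
      by_contra! hcon
      have hlt : ∑ a : ZMod (m + 1), hammingNorm (x - fun _ => a) < ∑ _a : ZMod (m + 1), k :=
        Finset.sum_lt_sum_of_nonempty Finset.univ_nonempty fun a _ => hcon a
      have htot : ∑ a : ZMod (m + 1), hammingNorm (x - fun _ => a) + N = (m + 1) * N := by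
        have := Finset.sum_congr rfl fun a (_ : a ∈ Finset.univ) => hcompl a
        rw [Finset.sum_add_distrib, hsum] at this
        simpa [ZMod.card] using this
      simp only [Finset.sum_const, Finset.card_univ, ZMod.card, smul_eq_mul] at hlt
      have h3 : m * N < (m + 1) * k := by nlinarith
      have h4 : (m * N : ℝ) < (m + 1) * k := by exact_mod_cast h3
      unfold c at hk
      rw [div_mul_eq_mul_div, le_div_iff₀ (by positivity)] at hk
      linarith
    refine Finset.mem_biUnion.2 ⟨a, Finset.mem_univ a, Finset.mem_image.2
      ⟨x - fun _ => a, by simp [hA, ha], by simp⟩⟩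
  have := (Finset.card_le_card hcover).trans Finset.card_biUnion_le
  have h2 := this.trans (Finset.sum_le_sum fun a _ => Finset.card_image_le)
  simpa [ZMod.card] using h2

/-- At parameter `c m` the binomial law is that of the norm of a uniformly random point, so counting
points suffices. -/
theorem le_binomTail_c (m N k : ℕ) (hk : (k : ℝ) ≤ c m * N) :
    1 / ((m : ℝ) + 1) ≤ binomTail N k (c m) := by
  have hcard : (Finset.univ.filter fun x : Torus m N => k ≤ hammingNorm x).card =
      ∑ v ∈ Finset.Ico k (N + 1), (sphere m N v).card := by
    rw [Finset.card_eq_sum_card_fiberwise (f := fun x => hammingNorm x)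
      (t := Finset.Ico k (N + 1))]
    · refine Finset.sum_congr rfl fun v hv => congrArg Finset.card ?_
      ext x
      have := (Finset.mem_Ico.1 hv).1
      simp only [sphere, Finset.mem_filter, Finset.mem_univ, true_and]
      constructor
      · exact fun h => h.2
      · exact fun h => ⟨h ▸ this, h⟩
    · intro x hx
      have h1 : k ≤ hammingNorm x := by simpa using hx
      have h2 : hammingNorm x ≤ N := by simpa using hammingNorm_le_card_fintype (x := x)
      simp only [Finset.coe_Ico, Set.mem_Ico]
      omega
  have h := card_le_card_large m N k hk
  rw [hcard] at h
  have h' : ((m : ℝ) + 1) ^ N ≤ (m + 1) * ∑ v ∈ Finset.Ico k (N + 1), ((sphere m N v).card : ℝ) := by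
    exact_mod_cast h
  simp only [binomTail, binomProb_c, ← Finset.sum_div]
  rw [div_le_div_iff₀ (by positivity) (by positivity)]
  linarith

/-- Every initial block of radii is charged by the binomial distributions with a comparably
small parameter. -/
theorem exists_le_binomTail (hm : 1 ≤ m) (N K : ℕ) (hK : (K : ℝ) ≤ c m * N) :
    ∃ P ∈ Set.Icc 0 (c m), P * (N + 1) ≤ 4 * (K + 1) ∧
      ∀ k ≤ K, m / ((m : ℝ) + 1) ^ 2 ≤ binomTail (N + 1) (k + 1) P := by
  have hc := c_mem m
  have hc0 : 0 < c m := by unfold c; positivity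
  suffices h : ∃ P ∈ Set.Icc 0 (c m), P * (N + 1) ≤ 4 * (K + 1) ∧
      m / ((m : ℝ) + 1) ^ 2 ≤ binomTail (N + 1) (K + 1) P by
    obtain ⟨P, hP, h1, h2⟩ := h
    exact ⟨P, hP, h1, fun k hk => h2.trans (binomTail_anti _ (by omega) ⟨hP.1, hP.2.trans hc.2⟩)⟩
  -- The natural choice is `P = 4 (K + 1) / (N + 1)`, but `P` may not exceed `c m`, the parameter of
  -- full noise `s = 0`.
  rcases le_or_gt (c m * (N + 1)) (4 * (K + 1)) with h | h
  · refine ⟨c m, ⟨hc.1, le_rfl⟩, h, ((mul_le_mul_of_nonneg_left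
      (le_binomTail_c m N K hK) hc.1).trans' (le_of_eq ?_)).trans (mul_binomTail_le N K hc)⟩
    unfold c
    field_simp
  -- The mean is now `4 (K + 1)`, well above `K`, so Chebyshev leaves a tail of at least `5 / 9`,
  -- while `m / (m + 1) ^ 2 ≤ 1 / 4`.
  · have hN : (0 : ℝ) < N + 1 := by positivity
    have hKpos : (0 : ℝ) < K + 1 := by positivity
    have hPc : 4 * (K + 1) / (N + 1) ≤ c m := by
      rw [div_le_iff₀ hN]; exact h.le
    refine ⟨4 * (K + 1) / (N + 1), ⟨by positivity, hPc⟩, by field_simp; rfl, ?_⟩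
    have hmul : ((N + 1 : ℕ) : ℝ) * (4 * (K + 1) / (N + 1)) = 4 * (K + 1) := by
      push_cast; field_simp
    have hKN : K ≤ N + 1 := by
      have : (K : ℝ) ≤ N := hK.trans (mul_le_of_le_one_left N.cast_nonneg hc.2)
      have : K ≤ N := by exact_mod_cast this
      omega
    have hcheb := one_sub_le_binomTail (N + 1) K ⟨by positivity, hPc.trans hc.2⟩ hKN
      (by rw [hmul]; linarith)
    rw [hmul] at hcheb
    refine le_trans ?_ hcheb
    have h1 : 4 * ((K : ℝ) + 1) / (4 * (K + 1) - K) ^ 2 ≤ 4 / 9 := by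
      rw [div_le_div_iff₀ (by nlinarith) (by norm_num)]
      nlinarith [(Nat.cast_nonneg K : (0 : ℝ) ≤ K)]
    have h2 : m / ((m : ℝ) + 1) ^ 2 ≤ 1 / 4 := by
      rw [div_le_div_iff₀ (by positivity) (by norm_num)]
      nlinarith [sq_nonneg ((m : ℝ) - 1)]
    linarith

/-! ### Discretization of the integral. -/

/-- A Riemann sum for `∫₀^P binomProb N k` over the points `c_m (1 - q ^ j)`, with a small step,
recovers half of a lower bound for the integral. -/
theorem exists_riemann_sum_ge (m : ℕ) {P : ℝ} (hP : P ∈ Set.Icc 0 (c m)) {δ η : ℝ} (hη : 0 < η)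
    (hη1 : η < 1) (N : ℕ) (hδ : (N + 1 : ℝ) ^ 2 * η ≤ δ) (hm : 0 < c m) :
    ∃ J : ℕ, c m * (1 - (1 - η) ^ J) ≤ P ∧ ∀ k, 2 * δ ≤ binomTail (N + 1) (k + 1) P →
      δ ≤ (N + 1) * ∑ j ∈ Finset.range J, c m * η * (1 - η) ^ j *
        binomProb N k (c m * (1 - (1 - η) ^ j)) := by
  have hc := c_mem m
  set p : ℕ → ℝ := fun j => c m * (1 - (1 - η) ^ j) with hp
  have hq0 : 0 ≤ 1 - η := by linarith
  have hq1 : 1 - η < 1 := by linarith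
  have hstep : ∀ j, p (j + 1) - p j = c m * η * (1 - η) ^ j := fun j => by
    simp only [hp, pow_succ]; ring
  have hstep_nonneg : ∀ j, 0 ≤ p (j + 1) - p j := fun j => by
    rw [hstep]; have := hc.1; positivity
  have hstep_le : ∀ j, p (j + 1) - p j ≤ η := fun j => by
    rw [hstep]
    calc c m * η * (1 - η) ^ j ≤ 1 * η * 1 := by
          gcongr
          · exact hc.2
          · exact pow_le_one₀ hq0 hq1.le
      _ = η := by ring
  have hpmem : ∀ j, p j ∈ Set.Icc (0 : ℝ) 1 := fun j => by
    have h1 := pow_nonneg hq0 j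
    have h2 := pow_le_one₀ (n := j) hq0 hq1.le
    exact ⟨mul_nonneg hc.1 (by linarith), mul_le_one₀ hc.2 (by linarith) (by linarith)⟩
  have hp0 : p 0 = 0 := by simp [hp]
  have hex : ∃ j, P - η < p j := by
    obtain ⟨j, hj⟩ := exists_pow_lt_of_lt_one hη hq1
    refine ⟨j, ?_⟩
    have h1 : c m * (1 - η) ^ j ≤ (1 - η) ^ j := mul_le_of_le_one_left (pow_nonneg hq0 j) hc.2
    have h2 := hP.2
    simp only [hp]
    linarith
  classical
  -- The first grid point beyond `P - η` cannot overshoot `P`, since steps are at most `η`.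
  obtain ⟨J, hJ, hJP⟩ : ∃ J, P - η < p J ∧ p J ≤ P := by
    refine ⟨Nat.find hex, Nat.find_spec hex, ?_⟩
    rcases h : Nat.find hex with _ | j
    · rw [hp0]; exact hP.1
    · have h1 := Nat.find_min hex (m := j) (by omega)
      have h2 := hstep_le j
      linarith
  refine ⟨J, hJP, fun k hk => ?_⟩
  have hPmem : P ∈ Set.Icc (0 : ℝ) 1 := ⟨hP.1, hP.2.trans hc.2⟩
  have hlast := (binomTail_sub_le N k (hpmem J) hPmem hJP).2
  have hzero : binomTail (N + 1) (k + 1) 0 = 0 := by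
    refine Finset.sum_eq_zero fun v hv => ?_
    have : v ≠ 0 := by have := (Finset.mem_Ico.1 hv).1; omega
    simp [binomProb_eq, this]
  have htele := Finset.sum_range_sub (fun j => binomTail (N + 1) (k + 1) (p j)) J
  have htele' := Finset.sum_range_sub p J
  simp only [hp0, hzero, sub_zero] at htele htele'
  have hbound : ∀ j ∈ Finset.range J,
      binomTail (N + 1) (k + 1) (p (j + 1)) - binomTail (N + 1) (k + 1) (p j) ≤
        (N + 1) * (c m * η * (1 - η) ^ j * binomProb N k (p j)) +
          (N + 1) * N * η * (p (j + 1) - p j) := by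
    intro j _
    refine (binomTail_sub_le N k (hpmem j) (hpmem (j + 1))
      (sub_nonneg.1 (hstep_nonneg j))).1.trans ?_
    rw [← hstep j]
    have h1 := mul_le_mul_of_nonneg_left (hstep_le j) (hstep_nonneg j)
    have h2 : (0 : ℝ) ≤ (N + 1) * N := by positivity
    have h3 := mul_le_mul_of_nonneg_left h1 h2
    linarith
  have hsum := Finset.sum_le_sum hbound
  rw [htele, Finset.sum_add_distrib, ← Finset.mul_sum, ← Finset.mul_sum, htele'] at hsum
  have hN : (0 : ℝ) ≤ N := N.cast_nonneg
  have h4 : (N + 1 : ℝ) * N * η * p J ≤ (N + 1) * N * η :=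
    mul_le_of_le_one_right (by positivity) (hpmem J).2
  have h5 : (N + 1 : ℝ) * (P - p J) ≤ (N + 1) * η := by gcongr; linarith
  -- The Riemann error and the leftover interval `[p J, P]` together cost at most `δ`, half of the
  -- tail bound.
  have h6 : (N + 1 : ℝ) ^ 2 * η = (N + 1) * N * η + (N + 1) * η := by ring
  linarith

/-! ### Pointwise domination and the weak type bound. -/

theorem noise_eq_binomProb (hm : 1 ≤ m) (s : ℝ) (y : Torus m N) :
    noise m N s y = binomProb N (hammingNorm y) (c m * (1 - s)) *
      ((sphere m N (hammingNorm y)).card : ℝ)⁻¹ := by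
  have hle : hammingNorm y ≤ N := by simpa using hammingNorm_le_card_fintype (x := y)
  have hm' : (m : ℝ) ≠ 0 := by positivity
  have hch : (N.choose (hammingNorm y) : ℝ) ≠ 0 := by
    exact_mod_cast (Nat.choose_pos hle).ne'
  rw [binomProb_eq, card_sphere, mul_assoc (Nat.choose _ _ : ℝ), ← noise_eq hm]
  push_cast
  field_simp

theorem norm_smoothAverage_le (K : ℕ) (f : Torus m N → ℂ) (x : Torus m N) :
    ((K : ℝ) + 1) * ‖smoothAverage K f x‖ ≤
      ∑ y with hammingNorm y ≤ K, ((sphere m N (hammingNorm y)).card : ℝ)⁻¹ * ‖f (x - y)‖ := by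
  have hK : ‖((K : ℂ) + 1)⁻¹‖ = ((K : ℝ) + 1)⁻¹ := by
    rw [norm_inv]
    congr 1
    exact_mod_cast Complex.norm_natCast (K + 1)
  rw [smoothAverage, norm_mul, hK, mul_inv_cancel_left₀ (by positivity)]
  have hsig : ∑ k ∈ Finset.range (K + 1), conv (sigma m N k) f x =
      ∑ y with hammingNorm y ≤ K, ((sphere m N (hammingNorm y)).card : ℂ)⁻¹ * f (x - y) := by
    simp only [conv]
    rw [Finset.sum_comm, Finset.sum_filter]
    refine Finset.sum_congr rfl fun y _ => ?_
    simp [sigma, sphere]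
  rw [hsig]
  refine (norm_sum_le _ _).trans (le_of_eq ?_)
  simp

/-- Outside the exceptional set of the ergodic maximal function, all smooth local averages are
small. -/
theorem norm_smoothAverage_le_of_ergodic (hm : 1 ≤ m) {f : Torus m N → ℂ} {x : Torus m N}
    {t η : ℝ} (ht : 0 ≤ t) (hη : 0 < η) (hη1 : η < 1)
    (hηδ : (N + 1 : ℝ) ^ 2 * η ≤ m / ((m : ℝ) + 1) ^ 2 / 2)
    (hx : ∀ k : ℕ, ∑ j ∈ Finset.range k,
      (convEnd (noise m N (1 - η)) ^ j) (fun y => ‖f y‖) x ≤ k * t)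
    {K : ℕ} (hK : (K : ℝ) ≤ c m * N) :
    ‖smoothAverage K f x‖ ≤ 8 * ((m : ℝ) + 1) ^ 2 / m * t := by
  have hc := c_mem m
  have hc0 : 0 < c m := by unfold c; positivity
  have hm0 : (0 : ℝ) < m := by positivity
  set δ : ℝ := m / ((m : ℝ) + 1) ^ 2 / 2 with hδ
  have hδ0 : 0 < δ := by positivity
  have hq0 : 0 ≤ 1 - η := by linarith
  have hq1 : 1 - η ≤ 1 := by linarith
  obtain ⟨P, hP, hPK, hPtail⟩ := exists_le_binomTail hm N K hK
  obtain ⟨J, hJP, hJ⟩ := exists_riemann_sum_ge m hP hη hη1 N hηδ hc0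
  set w : ℕ → ℝ := fun j => c m * η * (1 - η) ^ j with hw
  have hw0 : ∀ j, 0 ≤ w j := fun j => by simp only [hw]; positivity
  have hwanti : Antitone w := fun i j hij =>
    mul_le_mul_of_nonneg_left (pow_le_pow_of_le_one hq0 hq1 hij) (by positivity)
  have hwsum : ∑ j ∈ Finset.range J, w j = c m * (1 - (1 - η) ^ J) := by
    rw [← Finset.mul_sum]
    linear_combination c m * geom_sum_mul_neg (1 - η) J
  have hsmall := (sum_antitone_mul_le hwanti hw0 J fun k _ => hx k).trans
    (mul_le_mul_of_nonneg_right (hwsum.trans_le hJP) ht)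
  -- Both kernels are radial, so the comparison at `y` is the Riemann sum bound for `k = hammingNorm
  -- y`.
  have hdom : ∀ y : Torus m N, hammingNorm y ≤ K →
      δ * ((sphere m N (hammingNorm y)).card : ℝ)⁻¹ ≤
        (N + 1) * ∑ j ∈ Finset.range J, w j * noise m N ((1 - η) ^ j) y := by
    intro y hy
    simp only [noise_eq_binomProb hm, ← mul_assoc]
    rw [← Finset.sum_mul, ← mul_assoc]
    refine mul_le_mul_of_nonneg_right (hJ _ ?_) (by positivity)
    have := hPtail _ hy
    simp only [hδ]
    linarith
  have hnoise : ∀ j, 0 ≤ noise m N ((1 - η) ^ j) := fun j =>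
    noise_nonneg (pow_nonneg hq0 j) (pow_le_one₀ hq0 hq1)
  have hkey : δ * ((K + 1) * ‖smoothAverage K f x‖) ≤ (N + 1) * (P * t) := by
    calc δ * ((K + 1) * ‖smoothAverage K f x‖)
        ≤ δ * ∑ y with hammingNorm y ≤ K,
            ((sphere m N (hammingNorm y)).card : ℝ)⁻¹ * ‖f (x - y)‖ :=
          mul_le_mul_of_nonneg_left (norm_smoothAverage_le K f x) hδ0.le
      _ ≤ ∑ y with hammingNorm y ≤ K,
            ((N + 1) * ∑ j ∈ Finset.range J, w j * noise m N ((1 - η) ^ j) y) * ‖f (x - y)‖ := by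
          rw [Finset.mul_sum]
          refine Finset.sum_le_sum fun y hy => ?_
          rw [← mul_assoc]
          exact mul_le_mul_of_nonneg_right (hdom y (Finset.mem_filter.1 hy).2) (norm_nonneg _)
      _ ≤ ∑ y, ((N + 1) * ∑ j ∈ Finset.range J, w j * noise m N ((1 - η) ^ j) y) *
            ‖f (x - y)‖ :=
          Finset.sum_le_sum_of_subset_of_nonneg (Finset.filter_subset _ _) fun y _ _ =>
            mul_nonneg (mul_nonneg (by positivity) (Finset.sum_nonneg fun j _ =>
              mul_nonneg (hw0 j) (hnoise j y))) (norm_nonneg _)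
      _ = (N + 1) * ∑ j ∈ Finset.range J,
            w j * (convEnd (noise m N (1 - η)) ^ j) (fun y => ‖f y‖) x := by
          simp only [convEnd_noise_pow, convEnd_apply, Finset.mul_sum, Finset.sum_mul]
          rw [Finset.sum_comm]
          simp only [mul_assoc]
      _ ≤ (N + 1) * (P * t) := mul_le_mul_of_nonneg_left hsmall (by positivity)
  have h2 : δ * ((K + 1) * ‖smoothAverage K f x‖) ≤ 4 * (K + 1) * t := by
    have := mul_le_mul_of_nonneg_right hPK ht
    linarith
  have h3 : δ * ‖smoothAverage K f x‖ ≤ 4 * t := by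
    have hK1 : (0 : ℝ) < K + 1 := by positivity
    refine le_of_mul_le_mul_left ?_ hK1
    linarith
  have h4 : ‖smoothAverage K f x‖ ≤ 4 * t / δ := by
    rw [le_div_iff₀ hδ0]; linarith
  refine h4.trans (le_of_eq ?_)
  rw [hδ]
  field_simp
  ring

theorem mul_card_smoothLocalMax_le (hm : 1 ≤ m) (f : Torus m N → ℂ) {t : ℝ} (ht : 0 ≤ t) :
    t * (Finset.univ.filter fun x => t < |smoothLocalMax f x|).card ≤
      8 * ((m : ℝ) + 1) ^ 2 / m * ∑ x, ‖f x‖ := by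
  classical
  have hm0 : (0 : ℝ) < m := by positivity
  set C : ℝ := 8 * ((m : ℝ) + 1) ^ 2 / m with hC
  have hC0 : 0 < C := by positivity
  set δ : ℝ := m / ((m : ℝ) + 1) ^ 2 / 2 with hδ
  have hδ0 : 0 < δ := by positivity
  have hδ1 : δ < 1 := by
    rw [hδ, div_div, div_lt_one (by positivity)]
    nlinarith
  -- The step may shrink with `N`, because the ergodic bound does not depend on `T`.
  set η : ℝ := δ / (N + 1 : ℝ) ^ 2 with hη
  have hη0 : 0 < η := by positivity
  have hN1 : (1 : ℝ) ≤ (N + 1 : ℝ) ^ 2 :=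
    one_le_pow₀ (by have := (N.cast_nonneg : (0 : ℝ) ≤ N); linarith)
  have hη1 : η < 1 := (div_le_self hδ0.le hN1).trans_lt hδ1
  have hηδ : (N + 1 : ℝ) ^ 2 * η ≤ δ := by rw [hη]; field_simp; rfl
  set T := convEnd (noise m N (1 - η)) with hT
  set F : Torus m N → ℝ := fun y => ‖f y‖ with hF
  have hF0 : 0 ≤ F := fun y => norm_nonneg _
  set A := Finset.univ.filter fun x => t < |smoothLocalMax f x| with hA
  have hbad : ∀ x ∈ A, ∃ k : ℕ, (k : ℝ) * (t / C) < ∑ j ∈ Finset.range k, (T ^ j) F x := by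
    intro x hx
    by_contra! hcon
    obtain ⟨⟨K, hK, hKeq⟩, -⟩ := isGreatest_smoothLocalMax f x
    have hle := norm_smoothAverage_le_of_ergodic hm (div_nonneg ht hC0.le) hη0 hη1 hηδ hcon hK
    have hlt := (Finset.mem_filter.1 hx).2
    rw [hKeq, abs_of_nonneg (norm_nonneg _)] at hlt
    rw [← hC, mul_div_cancel₀ _ hC0.ne'] at hle
    linarith
  choose! k hk using hbad
  -- Finitely many points need only a finite time horizon, as `card_ergodic_le` requires.
  set n := A.sup k with hn
  set E := Finset.univ.filter fun x =>
    ∃ k ≤ n, (k : ℝ) * (t / C) < ∑ j ∈ Finset.range k, (T ^ j) F x with hE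
  have hAE : A ⊆ E := fun x hx =>
    Finset.mem_filter.2 ⟨Finset.mem_univ x, k x, Finset.le_sup hx, hk x hx⟩
  have hnoise : 0 ≤ noise m N (1 - η) := noise_nonneg (by linarith) (by linarith)
  have hmax := card_ergodic_le T (convEnd_nonneg hnoise)
    (fun g _ => by rw [hT, sum_convEnd, sum_noise, one_mul])
    (convEnd_one _ (sum_noise _)) hF0 (t / C) n E (by simp [hE])
  have hcard : (A.card : ℝ) ≤ E.card := by exact_mod_cast Finset.card_le_card hAE
  have h1 := (mul_le_mul_of_nonneg_left hcard (div_nonneg ht hC0.le)).trans hmax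
  rw [div_mul_eq_mul_div, div_le_iff₀ hC0] at h1
  linarith

end HammingMaximal


theorem mainTheorem9 (m : ℕ) (hm : 1 ≤ m) :
    ∃ C : ℝ≥0, ∀ (N : ℕ) (f : HammingMaximal.Torus m N → ℂ),
      HammingMaximal.weakL1Norm (HammingMaximal.smoothLocalMax f) ≤
        (C : ℝ≥0∞) * HammingMaximal.l1Norm f := by
  refine ⟨8 * ((m : ℝ≥0) + 1) ^ 2 / m, fun N f => iSup_le fun t => ?_⟩
  have h := HammingMaximal.mul_card_smoothLocalMax_le hm f t.coe_nonneg
  have hl : HammingMaximal.l1Norm f = ((∑ x, ‖f x‖₊ : ℝ≥0) : ℝ≥0∞) := by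
    simp [HammingMaximal.l1Norm, enorm_eq_nnnorm]
  rw [hl, ← ENNReal.coe_natCast, ← ENNReal.coe_mul, ← ENNReal.coe_mul, ENNReal.coe_le_coe,
    ← NNReal.coe_le_coe]
  simpa using h
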